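/- Let $\mathbb K$ be $\mathbb R$ or $\mathbb C$, and let $\mathbf B$ be the category of Banach spaces over $\mathbb K$ and bounded linear operators. Let $\mathbf M$ be the category whose objects are the injective operators $f:X'\to X$ between Banach spaces and whose morphisms from $f:X'\to X$ to $g:Y'\to Y$ are the pairs of operators $u':X'\to Y'$, $u:X\to Y$ with $uf=gu'$. Let $\mathbf{hM}$ be the category with the same objects as $\mathbf M$ and with $\operatorname{Hom}_{\mathbf{hM}}(f,g)=\operatorname{Hom}_{\mathbf M}(f,g)/J(f,g)$, where $J(f,g)$ is the linear subspace of those $(u',u)$ for which there is an operator $r:X\to Y'$ with $u=gr$ and $u'=rf$. A morphism of $\mathbf{hM}$ is called a pulation if it is the class of a commutative square that is both a pushout and a pullback in $\mathbf B$. The Waelbroeck–Wegner category $\mathbf W$ is the localization of $\mathbf{hM}$ with respect to the pulations. A Banach space $X$ is regarded as the object $0\to X$ of $\mathbf W$. For a set $I$, $\ell_1(I)$ is the Banach space of absolutely summable families of scalars indexed by $I$. **Theorem.** An object of $\mathbf W$ is projective (that is, every morphism from it to an object $h$ factors through every epimorphism of $\mathbf W$ with codomain $h$) if and only if it is isomorphic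 in $\mathbf W$ to $\ell_1(I)$ for some set $I$. -/

import Mathlib

open CategoryTheory

universe u

/-- A Banach space over `𝕜`. These are the objects of the category `B`. -/
structure Ban (𝕜 : Type) [RCLike 𝕜] : Type (u + 1) where
  carrier : Type u
  [normedAddCommGroup : NormedAddCommGroup carrier]
  [normedSpace : NormedSpace 𝕜 carrier]
  [completeSpace : CompleteSpace carrier]

namespace Ban

variable {𝕜 : Type} [RCLike 𝕜]

instance : CoeSort (Ban.{u} 𝕜) (Type u) := ⟨Ban.carrier⟩

attribute [instance] Ban.normedAddCommGroup Ban.normedSpace Ban.completeSpace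

/-- The morphisms of `B` are the operators, i.e. the bounded linear maps. -/
@[ext]
structure Hom (X Y : Ban.{u} 𝕜) : Type u where
  toCLM : X →L[𝕜] Y

/-- The category `B` of Banach spaces and operators. -/
instance : Category.{u} (Ban.{u} 𝕜) where
  Hom X Y := Hom X Y
  id X := ⟨ContinuousLinearMap.id 𝕜 X⟩
  comp f g := ⟨g.toCLM.comp f.toCLM⟩

@[ext]
theorem hom_ext {X Y : Ban.{u} 𝕜} {f g : X ⟶ Y} (h : f.toCLM = g.toCLM) : f = g :=
  Hom.ext h

@[simp]
theorem id_toCLM (X : Ban.{u} 𝕜) : (𝟙 X : X ⟶ X).toCLM = ContinuousLinearMap.id 𝕜 X := rfl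

@[simp]
theorem comp_toCLM {X Y Z : Ban.{u} 𝕜} (f : X ⟶ Y) (g : Y ⟶ Z) :
    (f ≫ g).toCLM = g.toCLM.comp f.toCLM := rfl

variable (𝕜) in
/-- The zero Banach space. -/
def zero : Ban.{u} 𝕜 := ⟨PUnit.{u + 1}⟩

/-- The zero operator from the zero space to `X`. -/
def fromZero (X : Ban.{u} 𝕜) : zero.{u} 𝕜 ⟶ X := ⟨0⟩

theorem fromZero_injective (X : Ban.{u} 𝕜) : Function.Injective (fromZero X).toCLM :=
  fun _ _ _ => rfl

variable (𝕜) in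
/-- The Banach space `ℓ₁(I)` of absolutely summable families of scalars indexed by `I`. -/
noncomputable def ell1 (I : Type u) : Ban.{u} 𝕜 := ⟨lp (fun _ : I => 𝕜) 1⟩

end Ban

/-- The category `M`: its objects are the injective operators `f : X' → X` between Banach spaces,
its morphisms are the commutative squares. -/
abbrev BanMono (𝕜 : Type) [RCLike 𝕜] : Type (u + 1) :=
  ObjectProperty.FullSubcategory (C := Arrow (Ban.{u} 𝕜))
    (fun f => Function.Injective f.hom.toCLM)

namespace BanMono

variable {𝕜 : Type} [RCLike 𝕜]

/-- Two morphisms `u, v : f ⟶ g` of `M`, from `f : X' → X` to `g : Y' → Y`, are homotopic if the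
square `u - v` has a diagonal: an operator `r : X → Y'` with `u - v = g r` and `u' - v' = r f`. -/
def homotopic : HomRel (BanMono.{u} 𝕜) := fun f g u v =>
  ∃ r : f.obj.right →L[𝕜] g.obj.left,
    u.hom.right.toCLM - v.hom.right.toCLM = g.obj.hom.toCLM.comp r ∧
    u.hom.left.toCLM - v.hom.left.toCLM = r.comp f.obj.hom.toCLM

/-- So the hom-sets of the quotient category `hM` below are exactly the quotients of the hom-sets
of `M` by this relation. -/
instance : Congruence (homotopic (𝕜 := 𝕜)) where
  equivalence := by
    intro f g
    refine ⟨fun u => ⟨0, by simp, by simp⟩, ?_, ?_⟩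
    · rintro u v ⟨r, h, h'⟩
      exact ⟨-r, by rw [ContinuousLinearMap.comp_neg, ← h, neg_sub],
        by rw [ContinuousLinearMap.neg_comp, ← h', neg_sub]⟩
    · rintro u v w ⟨r, h, h'⟩ ⟨s, k, k'⟩
      exact ⟨r + s, by rw [ContinuousLinearMap.comp_add, ← h, ← k, sub_add_sub_cancel],
        by rw [ContinuousLinearMap.add_comp, ← h', ← k', sub_add_sub_cancel]⟩
  comp_left := by
    rintro e f g t u v ⟨r, h, h'⟩
    have ht : f.obj.hom.toCLM.comp t.hom.left.toCLM = t.hom.right.toCLM.comp e.obj.hom.toCLM :=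
      congrArg Ban.Hom.toCLM t.hom.w
    refine ⟨r.comp t.hom.right.toCLM, ?_, ?_⟩
    · simp only [ObjectProperty.FullSubcategory.comp_hom, Arrow.comp_right, Ban.comp_toCLM]
      rw [← ContinuousLinearMap.sub_comp, h, ContinuousLinearMap.comp_assoc]
    · simp only [ObjectProperty.FullSubcategory.comp_hom, Arrow.comp_left, Ban.comp_toCLM]
      rw [← ContinuousLinearMap.sub_comp, h', ContinuousLinearMap.comp_assoc, ht,
        ContinuousLinearMap.comp_assoc]
  comp_right := by
    rintro f g k u v t ⟨r, h, h'⟩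
    have ht : k.obj.hom.toCLM.comp t.hom.left.toCLM = t.hom.right.toCLM.comp g.obj.hom.toCLM :=
      congrArg Ban.Hom.toCLM t.hom.w
    refine ⟨t.hom.left.toCLM.comp r, ?_, ?_⟩
    · simp only [ObjectProperty.FullSubcategory.comp_hom, Arrow.comp_right, Ban.comp_toCLM]
      rw [← ContinuousLinearMap.comp_sub, h, ← ContinuousLinearMap.comp_assoc, ← ht,
        ContinuousLinearMap.comp_assoc]
    · simp only [ObjectProperty.FullSubcategory.comp_hom, Arrow.comp_left, Ban.comp_toCLM]
      rw [← ContinuousLinearMap.comp_sub, h', ContinuousLinearMap.comp_assoc]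

variable (𝕜) in
/-- The embedding of `B` into `M`: a Banach space `X` is sent to `0 → X`. -/
def ofBan : Ban.{u} 𝕜 ⥤ BanMono.{u} 𝕜 where
  obj X := ⟨Arrow.mk (Ban.fromZero X), Ban.fromZero_injective X⟩
  map {X Y} φ := ObjectProperty.homMk
    (Arrow.homMk (𝟙 (Ban.zero 𝕜)) φ (by ext x; exact (map_zero φ.toCLM).symm))

end BanMono

/-- The category `hM`: the objects of `M`, with homotopic morphisms identified. -/
abbrev BanHMono (𝕜 : Type) [RCLike 𝕜] : Type (u + 1) :=
  CategoryTheory.Quotient (BanMono.homotopic.{u} (𝕜 := 𝕜))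

/-- A morphism of `hM` is a pulation if it is the class of a commutative square which is both a
pullback and a pushout in the category `B`. -/
def pulations (𝕜 : Type) [RCLike 𝕜] : MorphismProperty (BanHMono.{u} 𝕜) := fun f g φ =>
  ∃ v : f.as ⟶ g.as, (Quotient.functor BanMono.homotopic).map v = φ ∧
    BicartesianSq v.hom.left f.as.obj.hom g.as.obj.hom v.hom.right

/-- The Waelbroeck–Wegner category `W`: the localization of `hM` with respect to pulations. -/
abbrev Waelbroeck (𝕜 : Type) [RCLike 𝕜] : Type (u + 1) :=
  (pulations.{u} 𝕜).Localization

/-- The embedding of `B` into `W`: a Banach space `X` is sent to `0 → X`. -/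
noncomputable def Waelbroeck.ofBan (𝕜 : Type) [RCLike 𝕜] : Ban.{u} 𝕜 ⥤ Waelbroeck.{u} 𝕜 :=
  BanMono.ofBan 𝕜 ⋙ Quotient.functor BanMono.homotopic ⋙ (pulations 𝕜).Q

/-! Operators out of `ℓ₁(I)` lift through surjective operators, and every Banach space is a quotient
of some `ℓ₁(I)`. Pulling an injective operator back along such a quotient is a pulation, so every
object of `W` is isomorphic to some `X' → ℓ₁(I)` (`exists_resolution`). Such an object is colocal
for the pulations (`isColocal`), so its morphisms in `W` are those of `hM`
(`bijective_Q_map_of_isColocal`), and equations between them are explicit homotopies.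

If `v` is an epimorphism onto a resolved object `h : Y' → Y`, then `snd v` and `h` together cover
`Y` (`exists_add_of_epi`). Lifting an operator from `ℓ₁(I)` through this joint surjection gives a
factorization up to homotopy, so `ℓ₁(I)` is projective.

Conversely, let `f : X' → P` be projective with `P` of type `ℓ₁`. The identity of `P` gives an
epimorphism from `P` to `f`; it splits, and the homotopy that witnesses this is, up to sign, a left
inverse of `f`. Hence `f` is isomorphic to a complemented subspace of `P`. By Köthe's theorem
(`exists_equiv_of_retract`) this subspace is again some `ℓ₁(I)`. -/

/-- The Banach space of absolutely summable families of scalars indexed by `I`. -/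
abbrev EllOne (𝕜 : Type*) [RCLike 𝕜] (I : Type*) := lp (fun _ : I => 𝕜) 1

/-! ### Operators on `ℓ₁(I)`. -/

namespace EllOne

variable {𝕜 : Type*} [RCLike 𝕜] {I J : Type*}
variable {A B : Type*} [NormedAddCommGroup A] [NormedSpace 𝕜 A]
  [NormedAddCommGroup B] [NormedSpace 𝕜 B]

open scoped Classical in
/-- The unit vectors of `ℓ₁(I)`. -/
noncomputable def e (i : I) : EllOne 𝕜 I := lp.single 1 i (1 : 𝕜)

@[simp]
theorem norm_e (i : I) : ‖(e i : EllOne 𝕜 I)‖ = 1 := by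
  simp [e, lp.norm_single]

theorem e_apply_self (i : I) : (e i : EllOne 𝕜 I) i = 1 := by
  simp [e]

theorem e_apply_ne {i j : I} (h : j ≠ i) : (e i : EllOne 𝕜 I) j = 0 := by
  simp [e, h]

theorem hasSum_norm (x : EllOne 𝕜 I) : HasSum (fun i => ‖x i‖) ‖x‖ := by
  simpa using lp.hasSum_norm (by simp) x

theorem hasSum_smul_e (x : EllOne 𝕜 I) : HasSum (fun i => x i • (e i : EllOne 𝕜 I)) x := by
  classical
  have h : (fun i => x i • (e i : EllOne 𝕜 I)) = fun i => lp.single 1 i (x i) := funext fun i => by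
    rw [e, ← lp.single_smul, smul_eq_mul, mul_one]
  rw [h]
  exact lp.hasSum_single (by simp) x

/-- Operators on `ℓ₁(I)` which agree on the unit vectors are equal. -/
theorem clm_ext {S T : EllOne 𝕜 I →L[𝕜] B} (h : ∀ i, S (e i) = T (e i)) : S = T := by
  ext x
  have hS := (hasSum_smul_e x).mapL S
  have hT := (hasSum_smul_e x).mapL T
  simp only [map_smul, h] at hS hT
  exact hS.unique hT

/-- A bounded family extends to an operator on `ℓ₁(I)`. -/
theorem exists_clm [CompleteSpace B] (v : I → B) (C : ℝ) (hv : ∀ i, ‖v i‖ ≤ C) :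
    ∃ T : EllOne 𝕜 I →L[𝕜] B, (∀ i, T (e i) = v i) ∧ ∀ x, ‖T x‖ ≤ C * ‖x‖ := by
  have hn (x : EllOne 𝕜 I) : HasSum (fun i => C * ‖x i‖) (C * ‖x‖) := (hasSum_norm x).mul_left C
  have hle (x : EllOne 𝕜 I) (i : I) : ‖x i • v i‖ ≤ C * ‖x i‖ := by
    rw [norm_smul, mul_comm]
    gcongr
    exact hv i
  have hs (x : EllOne 𝕜 I) : Summable fun i => x i • v i :=
    .of_norm_bounded (hn x).summable (hle x)
  refine ⟨LinearMap.mkContinuous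
    { toFun := fun x => ∑' i, x i • v i
      map_add' := fun x y => ?_
      map_smul' := fun c x => ?_ } C fun x => ?_, fun i => ?_, fun x => ?_⟩
  · rw [← (hs x).tsum_add (hs y)]
    simp [add_smul]
  · simp only [lp.coeFn_smul, Pi.smul_apply, smul_assoc, RingHom.id_apply]
    exact (hs x).tsum_const_smul c
  · exact tsum_of_norm_bounded (hn x) (hle x)
  · simp only [LinearMap.mkContinuous_apply, LinearMap.coe_mk, AddHom.coe_mk]
    rw [tsum_eq_single i fun j hj => by rw [e_apply_ne hj, zero_smul], e_apply_self, one_smul]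
  · exact tsum_of_norm_bounded (hn x) (hle x)

theorem norm_apply_le {T : EllOne 𝕜 I →L[𝕜] B} {C : ℝ} (hT : ∀ i, ‖T (e i)‖ ≤ C)
    (x : EllOne 𝕜 I) : ‖T x‖ ≤ C * ‖x‖ := by
  have h := (hasSum_smul_e x).mapL T
  rw [← h.tsum_eq]
  refine tsum_of_norm_bounded ((hasSum_norm x).mul_left C) fun i => ?_
  rw [map_smul, norm_smul, mul_comm]
  gcongr
  exact hT i

/-- Operators on `ℓ₁(I)` lift through surjective operators. -/
theorem exists_lift [CompleteSpace A] [CompleteSpace B] (T : A →L[𝕜] B)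
    (hT : Function.Surjective T) (S : EllOne 𝕜 I →L[𝕜] B) :
    ∃ S' : EllOne 𝕜 I →L[𝕜] A, T.comp S' = S := by
  obtain ⟨C, hC, h⟩ := T.exists_preimage_norm_le hT
  choose g hg hgn using h
  obtain ⟨S', hS', -⟩ := exists_clm (𝕜 := 𝕜) (fun i => g (S (e i))) (C * ‖S‖) fun i =>
    (hgn _).trans <| by
      gcongr
      simpa using S.le_opNorm (e i)
  exact ⟨S', clm_ext fun i => by simp [hS', hg]⟩

/-- Every Banach space is a quotient of a space `ℓ₁(I)`. -/
theorem exists_surjective (𝕜 : Type*) [RCLike 𝕜] (B : Type u) [NormedAddCommGroup B]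
    [NormedSpace 𝕜 B] [CompleteSpace B] :
    ∃ (I : Type u) (q : EllOne 𝕜 I →L[𝕜] B), Function.Surjective q := by
  obtain ⟨q, hq, -⟩ := exists_clm (𝕜 := 𝕜) (fun i : Metric.closedBall (0 : B) 1 => (i : B)) 1
    fun i => mem_closedBall_zero_iff.1 i.2
  refine ⟨_, q, fun y => ?_⟩
  obtain rfl | hy := eq_or_ne y 0
  · exact ⟨0, map_zero q⟩
  have hy' : (‖y‖ : 𝕜) ≠ 0 := by simpa using hy
  -- The index set is the closed unit ball itself, so normalizing `y` gives an index.
  let i : Metric.closedBall (0 : B) 1 := ⟨(‖y‖ : 𝕜)⁻¹ • y, by simp [norm_smul, hy]⟩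
  exact ⟨(‖y‖ : 𝕜) • e i, by rw [map_smul, hq, smul_inv_smul₀ hy']⟩

/-- The operator which moves the unit vectors along a map. -/
theorem exists_push (φ : I → J) :
    ∃ T : EllOne 𝕜 I →L[𝕜] EllOne 𝕜 J, ∀ i, T (e i) = e (φ i) :=
  (exists_clm (fun i => e (φ i)) 1 fun _ => (norm_e _).le).imp fun _ h => h.1

/-- The operator which restricts families along an injective map. -/
theorem exists_pull {φ : I → J} (hφ : Function.Injective φ) :
    ∃ T : EllOne 𝕜 J →L[𝕜] EllOne 𝕜 I, (∀ i, T (e (φ i)) = e i) ∧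
      (∀ j ∉ Set.range φ, T (e j) = 0) ∧ ∀ x i, T x i = x (φ i) := by
  classical
  obtain ⟨T, hT, -⟩ := exists_clm (𝕜 := 𝕜) (fun j : J =>
    if h : j ∈ Set.range φ then (e h.choose : EllOne 𝕜 I) else 0) 1 fun j => by
      split_ifs <;> simp
  have h1 (i) : T (e (φ i)) = e i := by
    rw [hT, dif_pos ⟨i, rfl⟩]
    congr 1
    exact hφ (Set.mem_range_self (f := φ) i).choose_spec
  have h2 (j) (hj : j ∉ Set.range φ) : T (e j) = 0 := by rw [hT, dif_neg hj]
  refine ⟨T, h1, h2, fun x i => ?_⟩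
  have key : (lp.evalCLM 𝕜 (fun _ : I => 𝕜) 1 i).comp T = lp.evalCLM 𝕜 (fun _ : J => 𝕜) 1 (φ i) := by
    refine clm_ext fun j => ?_
    change T (e j) i = (e j : EllOne 𝕜 J) (φ i)
    by_cases hj : j ∈ Set.range φ
    · obtain ⟨k, rfl⟩ := hj
      rw [h1]
      by_cases hk : i = k
      · rw [hk, e_apply_self, e_apply_self]
      · rw [e_apply_ne hk, e_apply_ne (hφ.ne hk)]
    · rw [h2 j hj, e_apply_ne (fun h => hj ⟨i, h⟩)]
      rfl
  exact DFunLike.congr_fun key x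

/-- `ℓ₁` of a disjoint union. -/
theorem nonempty_equiv_sum :
    Nonempty (EllOne 𝕜 (I ⊕ J) ≃L[𝕜] EllOne 𝕜 I × EllOne 𝕜 J) := by
  obtain ⟨a, ha⟩ := exists_push (𝕜 := 𝕜) (Sum.inl : I → I ⊕ J)
  obtain ⟨b, hb⟩ := exists_push (𝕜 := 𝕜) (Sum.inr : J → I ⊕ J)
  obtain ⟨a', ha1, ha2, -⟩ := exists_pull (𝕜 := 𝕜) (Sum.inl_injective (α := I) (β := J))
  obtain ⟨b', hb1, hb2, -⟩ := exists_pull (𝕜 := 𝕜) (Sum.inr_injective (α := I) (β := J))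
  have hab : a'.comp b = 0 := clm_ext fun j => by simp [hb, ha2]
  have hba : b'.comp a = 0 := clm_ext fun j => by simp [ha, hb2]
  have haa : a'.comp a = .id 𝕜 _ := clm_ext fun j => by simp [ha, ha1]
  have hbb : b'.comp b = .id 𝕜 _ := clm_ext fun j => by simp [hb, hb1]
  have hadd : a.comp a' + b.comp b' = .id 𝕜 _ := clm_ext fun k => by
    rcases k with i | j
    · simp [ha1, ha, hb2]
    · simp [hb1, hb, ha2]
  refine ⟨.equivOfInverse (a'.prod b') (a.coprod b) (fun x => ?_) fun y => ?_⟩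
  · simpa using DFunLike.congr_fun hadd x
  · have h1 : a' (a y.1) = y.1 := DFunLike.congr_fun haa y.1
    have h2 : b' (b y.2) = y.2 := DFunLike.congr_fun hbb y.2
    have h3 : a' (b y.2) = 0 := DFunLike.congr_fun hab y.2
    have h4 : b' (a y.1) = 0 := DFunLike.congr_fun hba y.1
    ext1 <;> simp [h1, h2, h3, h4]

/-- `ℓ₁(I)` depends only on the cardinality of `I`. -/
theorem nonempty_equiv_congr (φ : I ≃ J) : Nonempty (EllOne 𝕜 I ≃L[𝕜] EllOne 𝕜 J) := by
  obtain ⟨a, ha⟩ := exists_push (𝕜 := 𝕜) φ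
  obtain ⟨b, hb⟩ := exists_push (𝕜 := 𝕜) φ.symm
  have hba : b.comp a = .id 𝕜 _ := clm_ext fun j => by simp [ha, hb]
  have hab : a.comp b = .id 𝕜 _ := clm_ext fun j => by simp [ha, hb]
  exact ⟨.equivOfInverse a b (DFunLike.congr_fun hba) (DFunLike.congr_fun hab)⟩

/-! ### Pełczyński decomposition. -/

variable {X : Type*} [NormedAddCommGroup X] [NormedSpace 𝕜 X]

/-- The Eilenberg swindle for a complemented subspace `X` of `ℓ₁(I)`. -/
theorem nonempty_equiv_prod_nat (i : X →L[𝕜] EllOne 𝕜 I) (p : EllOne 𝕜 I →L[𝕜] X)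
    (hpi : ∀ x, p (i x) = x) :
    Nonempty ((X × EllOne 𝕜 (ℕ × I)) ≃L[𝕜] EllOne 𝕜 (ℕ × I)) := by
  have hinj (n : ℕ) : Function.Injective (fun k : I => (n, k)) := fun a b h => (Prod.ext_iff.1 h).2
  have hsinj : Function.Injective (fun k : ℕ × I => (k.1 + 1, k.2)) := fun a b h => by
    simp only [Prod.mk.injEq, add_left_inj] at h
    exact Prod.ext h.1 h.2
  choose j hj using fun n : ℕ => exists_push (𝕜 := 𝕜) (fun k : I => (n, k))
  obtain ⟨π, hπ, hπ0, -⟩ := exists_pull (𝕜 := 𝕜) (hinj 0)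
  obtain ⟨R, hR⟩ := exists_push (𝕜 := 𝕜) (fun k : ℕ × I => (k.1 + 1, k.2))
  obtain ⟨L, hL, hL0, -⟩ := exists_pull (𝕜 := 𝕜) hsinj
  replace hπ0 (n k) : π (e (n + 1, k)) = 0 := hπ0 _ (by simp)
  replace hL0 (k) : L (e (0, k)) = 0 := hL0 _ (by simp)
  replace hL (n k) : L (e (n + 1, k)) = e (n, k) := hL (n, k)
  have hj1 (n x) : ‖j n x‖ ≤ ‖x‖ := by
    simpa using norm_apply_le (T := j n) (C := 1) (fun k => by simp [hj]) x
  -- `Q` applies the idempotent `i ∘ p` in each of the countably many copies of `ℓ₁(I)`, so its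
  -- range is an `ℓ₁`-sum of copies of `X`; `R` and `L` shift the copies up and down.
  obtain ⟨Q, hQ, -⟩ := exists_clm (𝕜 := 𝕜) (fun k : ℕ × I => j k.1 (i (p (e k.2))))
    (‖i.comp p‖) fun k => (hj1 _ _).trans (by simpa using (i.comp p).le_opNorm (e k.2))
  have r1 (x) : π (j 0 x) = x :=
    DFunLike.congr_fun (clm_ext (S := π.comp (j 0)) (T := .id 𝕜 _) fun k => by simp [hj, hπ]) x
  have r2 (x) : L (j 0 x) = 0 :=
    DFunLike.congr_fun (clm_ext (S := L.comp (j 0)) (T := 0) fun k => by simp [hj, hL0]) x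
  have r3 (x) : L (R x) = x :=
    DFunLike.congr_fun (clm_ext (S := L.comp R) (T := .id 𝕜 _) fun k => by simp [hR, hL]) x
  have r4 (x) : π (R x) = 0 :=
    DFunLike.congr_fun (clm_ext (S := π.comp R) (T := 0) fun k => by simp [hR, hπ0]) x
  have r5 (x) : j 0 (π x) + R (L x) = x :=
    DFunLike.congr_fun (clm_ext (S := (j 0).comp π + R.comp L) (T := .id 𝕜 _) fun ⟨n, k⟩ => by
      cases n <;> simp [hR, hπ0, hπ, hL, hL0, hj]) x
  have r6 (n x) : R (j n x) = j (n + 1) x :=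
    DFunLike.congr_fun (clm_ext (S := R.comp (j n)) (T := j (n + 1)) fun k => by simp [hR, hj]) x
  have r7 (n x) : Q (j n x) = j n (i (p x)) :=
    DFunLike.congr_fun (clm_ext (S := Q.comp (j n)) (T := (j n).comp (i.comp p))
      fun k => by simp [hQ, hj]) x
  have r8 (x) : Q (R x) = R (Q x) :=
    DFunLike.congr_fun (clm_ext (S := Q.comp R) (T := R.comp Q)
      fun k => by simp [hQ, hR, r6]) x
  have r9 (x) : Q (L x) = L (Q x) :=
    DFunLike.congr_fun (clm_ext (S := Q.comp L) (T := L.comp Q) fun ⟨n, k⟩ => by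
      cases n
      · simp [hQ, hL0, r2]
      · simp [hQ, hL, ← r6, r3]) x
  have r10 (x) : π (Q x) = i (p (π x)) :=
    DFunLike.congr_fun (clm_ext (S := π.comp Q) (T := (i.comp p).comp π) fun ⟨n, k⟩ => by
      cases n
      · simp [hQ, hπ, r1]
      · simp [hQ, hπ0, ← r6, r4]) x
  have r11 (x) : Q (Q x) = Q x :=
    DFunLike.congr_fun (clm_ext (S := Q.comp Q) (T := Q) fun k => by simp [hQ, r7, hpi]) x
  -- The forward map shifts the range of `Q` up by one copy, puts `X` into the vacated copy `0`, and
  -- fixes the kernel of `Q`.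
  refine ⟨.equivOfInverse
    (((j 0).comp i).coprod (R.comp Q + (.id 𝕜 _ - Q)))
    ((p.comp π).prod (L.comp Q + (.id 𝕜 _ - Q))) (fun x => ?_) fun z => ?_⟩
  · ext1
    · simp [r1, r4, r10, hpi]
    · simp [r2, r3, r7, r8, r11, hpi]
  · have h5 : j 0 (π (Q z)) + R (L (Q z)) = Q z := r5 (Q z)
    rw [r10] at h5
    simp only [ContinuousLinearMap.coprod_apply, ContinuousLinearMap.prod_apply,
      ContinuousLinearMap.comp_apply, add_apply, sub_apply,
      ContinuousLinearMap.id_apply, map_add, map_sub, r9, r11, sub_self, add_zero]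
    rw [← sub_eq_zero] at h5 ⊢
    rw [← h5]
    abel

theorem nonempty_equiv_prod_of_retract [Infinite I] (i : X →L[𝕜] EllOne 𝕜 I)
    (p : EllOne 𝕜 I →L[𝕜] X) (hpi : ∀ x, p (i x) = x) :
    Nonempty ((X × EllOne 𝕜 I) ≃L[𝕜] EllOne 𝕜 I) := by
  obtain ⟨s⟩ := nonempty_equiv_prod_nat i p hpi
  have : Nonempty (ℕ × I ≃ I) := by
    rw [← Cardinal.eq, Cardinal.mk_prod]
    simp
  obtain ⟨φ⟩ := this
  obtain ⟨t⟩ := nonempty_equiv_congr (𝕜 := 𝕜) φ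
  exact ⟨((ContinuousLinearEquiv.refl 𝕜 X).prodCongr t.symm).trans (s.trans t)⟩

/-- Pełczyński's decomposition method. -/
theorem nonempty_equiv_of_retracts [Infinite I] (i : X →L[𝕜] EllOne 𝕜 I)
    (p : EllOne 𝕜 I →L[𝕜] X) (hpi : ∀ x, p (i x) = x) (j : EllOne 𝕜 I →L[𝕜] X)
    (q : X →L[𝕜] EllOne 𝕜 I) (hqj : ∀ x, q (j x) = x) :
    Nonempty (X ≃L[𝕜] EllOne 𝕜 I) := by
  obtain ⟨s⟩ := nonempty_equiv_prod_of_retract i p hpi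
  have : Nonempty (I ≃ I ⊕ I) := by
    rw [← Cardinal.eq, Cardinal.mk_sum]
    simp
  obtain ⟨φ⟩ := this
  obtain ⟨t⟩ := nonempty_equiv_congr (𝕜 := 𝕜) φ
  obtain ⟨t'⟩ := nonempty_equiv_sum (𝕜 := 𝕜) (I := I) (J := I)
  let w : X ≃L[𝕜] EllOne 𝕜 I × q.ker := .equivOfRightInverse q j hqj
  -- `X ≃ E × ker q ≃ (E × E) × ker q ≃ E × X`, and the swindle `s` absorbs `X` into `E`.
  let E := EllOne 𝕜 I
  let a : X ≃L[𝕜] E × X :=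
    w.trans <| ((t.trans t').prodCongr (.refl 𝕜 _)).trans <|
      (ContinuousLinearEquiv.prodAssoc 𝕜 E E q.ker).trans <|
      (ContinuousLinearEquiv.refl 𝕜 E).prodCongr w.symm
  exact ⟨a.trans <| (ContinuousLinearEquiv.prodComm 𝕜 E X).trans s⟩

theorem exists_equiv_of_finiteDimensional (𝕜 : Type*) [RCLike 𝕜] (X : Type u)
    [NormedAddCommGroup X] [NormedSpace 𝕜 X] [FiniteDimensional 𝕜 X] :
    ∃ I : Type u, Nonempty (X ≃L[𝕜] EllOne 𝕜 I) := by
  have : CompleteSpace X := FiniteDimensional.complete 𝕜 X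
  let b := (Module.finBasis 𝕜 X).reindex Equiv.ulift.{u}.symm
  refine ⟨ULift.{u} (Fin (Module.finrank 𝕜 X)), ?_⟩
  obtain ⟨T, hT, -⟩ := exists_clm (𝕜 := 𝕜) b (∑ i, ‖b i‖) fun i =>
    Finset.single_le_sum (f := fun i => ‖b i‖) (fun _ _ => norm_nonneg _) (Finset.mem_univ i)
  let U : X →L[𝕜] EllOne 𝕜 (ULift.{u} (Fin (Module.finrank 𝕜 X))) :=
    LinearMap.toContinuousLinearMap (b.constr 𝕜 e)
  have hU (i) : U (b i) = e i := b.constr_basis 𝕜 _ i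
  have h1 : (U.comp T) = .id 𝕜 _ := clm_ext fun i => by simp [hT, hU]
  have h2 : T.toLinearMap ∘ₗ U.toLinearMap = .id := b.ext fun i => by simp [hT, hU]
  exact ⟨.equivOfInverse U T (LinearMap.congr_fun h2) (DFunLike.congr_fun h1)⟩

/-! ### Köthe's theorem on complemented subspaces of `ℓ₁(J)`. -/

/-- `ℓ₁(G)` has a dense subset of cardinality at most `#G`, if `G` is infinite. -/
theorem exists_dense (𝕜 : Type*) [RCLike 𝕜] (G : Type u) [Infinite G] :
    ∃ (K : Type u) (d : K → EllOne 𝕜 G), DenseRange d ∧ Cardinal.mk K ≤ Cardinal.mk G := by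
  let d : FreeAddMonoid (G × ℕ) →+ EllOne 𝕜 G :=
    FreeAddMonoid.lift fun k => TopologicalSpace.denseSeq 𝕜 k.2 • e k.1
  refine ⟨FreeAddMonoid (G × ℕ), d, fun x => ?_, ?_⟩
  · let M := (AddMonoidHom.mrange d).topologicalClosure
    have hM : IsClosed (M : Set (EllOne 𝕜 G)) := AddSubmonoid.isClosed_topologicalClosure _
    have he (c : 𝕜) (g : G) : c • (e g : EllOne 𝕜 G) ∈ M := by
      have hc : IsClosed {c : 𝕜 | c • (e g : EllOne 𝕜 G) ∈ M} := hM.preimage (by fun_prop)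
      refine (TopologicalSpace.denseRange_denseSeq 𝕜).induction_on c hc fun n => ?_
      refine AddSubmonoid.le_topologicalClosure _ ⟨FreeAddMonoid.of (g, n), ?_⟩
      simp [d]
    exact hM.mem_of_tendsto (hasSum_smul_e x)
      (.of_forall fun s => sum_mem fun g _ => he (x g) g)
  · change Cardinal.mk (List (G × ℕ)) ≤ _
    rw [Cardinal.mk_list_eq_mk, Cardinal.mk_prod]
    simp

/-- A normed space which embeds into `ℓ₁(G)` has a dense subset of cardinality at most `#G`. -/
theorem exists_dense_of_antilipschitz {G : Type u} [Infinite G] (T : X →L[𝕜] EllOne 𝕜 G) (C : ℝ)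
    (hT : ∀ x, ‖x‖ ≤ C * ‖T x‖) :
    ∃ (K : Type u) (d : K → X), DenseRange d ∧ Cardinal.mk K ≤ Cardinal.mk G := by
  obtain ⟨K, d, hd, hK⟩ := exists_dense 𝕜 G
  classical
  -- The points `d k` need not lie in the range of `T`, so for each precision `1 / (n + 1)` a nearby
  -- image point is chosen when there is one; `0` is a dummy value.
  let a : K × ℕ → X := fun k =>
    if h : ∃ x, ‖T x - d k.1‖ < 1 / (k.2 + 1 : ℝ) then h.choose else 0
  refine ⟨K × ℕ, a, fun x => Metric.mem_closure_range_iff.2 fun ε hε => ?_, ?_⟩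
  · have hC : 0 < |C| + 1 := by positivity
    obtain ⟨n, hn⟩ := exists_nat_one_div_lt (show 0 < ε / (2 * (|C| + 1)) by positivity)
    obtain ⟨k, hk⟩ := Metric.mem_closure_range_iff.1 (hd (T x)) (1 / (n + 1 : ℝ))
      (by positivity)
    rw [dist_eq_norm] at hk
    have h : ∃ x, ‖T x - d k‖ < 1 / (n + 1 : ℝ) := ⟨x, hk⟩
    refine ⟨(k, n), ?_⟩
    have ha : a (k, n) = h.choose := dif_pos h
    have h1 : ‖T (a (k, n)) - d k‖ < 1 / (n + 1 : ℝ) := ha ▸ h.choose_spec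
    have h2 : ‖T (x - a (k, n))‖ ≤ ε / (|C| + 1) := by
      rw [map_sub, ← sub_sub_sub_cancel_right _ _ (d k)]
      refine (norm_sub_le _ _).trans ?_
      have : ε / (|C| + 1) = ε / (2 * (|C| + 1)) + ε / (2 * (|C| + 1)) := by field_simp; ring
      linarith
    rw [dist_eq_norm]
    by_cases h0 : ‖T (x - a (k, n))‖ = 0
    · have := hT (x - a (k, n))
      rw [h0] at this
      linarith
    · calc ‖x - a (k, n)‖ ≤ C * ‖T (x - a (k, n))‖ := hT _
        _ < (|C| + 1) * ‖T (x - a (k, n))‖ := by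
          have := (norm_nonneg (T (x - a (k, n)))).lt_of_ne' h0
          gcongr
          exact (le_abs_self C).trans_lt (lt_add_one _)
        _ ≤ (|C| + 1) * (ε / (|C| + 1)) := by gcongr
        _ = ε := by field_simp
  · calc Cardinal.mk (K × ℕ) = Cardinal.mk K * Cardinal.aleph0 := by simp
      _ ≤ Cardinal.mk G * Cardinal.aleph0 := by gcongr
      _ = Cardinal.mk G := by simp

/-- A retract of some `ℓ₁(J)` is a retract of `ℓ₁(S)`, if it has a dense subset of cardinality at
most `#S`. -/
theorem exists_retract_of_dense {S J K : Type u} [Infinite S]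
    (i : X →L[𝕜] EllOne 𝕜 J) (p : EllOne 𝕜 J →L[𝕜] X) (hpi : ∀ x, p (i x) = x)
    (d : K → X) (hd : DenseRange d) (hK : Cardinal.mk K ≤ Cardinal.mk S) :
    ∃ (i' : X →L[𝕜] EllOne 𝕜 S) (p' : EllOne 𝕜 S →L[𝕜] X), ∀ x, p' (i' x) = x := by
  -- Each summable family has countable support, so `V` is no larger than `S`; by density every `i
  -- x` is supported in `V`.
  let V : Set J := ⋃ k, Function.support (i (d k))
  have hV (x : X) (j : J) (hj : j ∉ V) : i x j = 0 := by
    have hc : IsClosed {x : X | i x j = 0} :=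
      isClosed_eq ((lp.evalCLM 𝕜 (fun _ : J => 𝕜) 1 j).continuous.comp i.continuous)
        continuous_const
    refine hd.induction_on x hc fun k => ?_
    by_contra h
    exact hj (Set.mem_iUnion.2 ⟨k, h⟩)
  have hcard : Cardinal.mk V ≤ Cardinal.mk S := by
    refine (Cardinal.mk_iUnion_le _).trans ?_
    have hle : ⨆ k, Cardinal.mk (Function.support (i (d k))) ≤ Cardinal.aleph0 := by
      refine ciSup_le' fun k => ?_
      have := (hasSum_norm (i (d k))).summable.countable_support
      simp only [Function.support, ne_eq, norm_eq_zero] at this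
      exact Cardinal.mk_le_aleph0_iff.2 this
    calc _ ≤ Cardinal.mk S * Cardinal.aleph0 := by gcongr
      _ = Cardinal.mk S := by simp
  obtain ⟨φ⟩ := hcard
  obtain ⟨a, ha⟩ := exists_push (𝕜 := 𝕜) (Subtype.val : V → J)
  obtain ⟨b, hb1, hb2, hb⟩ := exists_pull (𝕜 := 𝕜) (Subtype.val_injective (p := (· ∈ V)))
  obtain ⟨a', ha'⟩ := exists_push (𝕜 := 𝕜) φ
  obtain ⟨b', hb', -, -⟩ := exists_pull (𝕜 := 𝕜) φ.injective
  have h1 : b'.comp a' = .id 𝕜 _ := clm_ext fun k => by simp [ha', hb']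
  have h2 (x : X) : a (b (i x)) = i x := by
    have h := ((hasSum_smul_e (i x)).mapL (a.comp b))
    have h' := hasSum_smul_e (i x)
    refine h.unique ?_
    convert! h' using 2 with j
    by_cases hj : j ∈ V
    · have := hb1 ⟨j, hj⟩
      simp only at this
      simp [this, ha]
    · simp [hV x j hj]
  refine ⟨a'.comp (b.comp i), p.comp (a.comp b'), fun x => ?_⟩
  have h3 : b' (a' (b (i x))) = b (i x) := DFunLike.congr_fun h1 _
  simp [h3, h2, hpi]

theorem exists_mul_eq_norm (z : 𝕜) : ∃ θ : 𝕜, ‖θ‖ ≤ 1 ∧ z * θ = ‖z‖ := by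
  obtain rfl | hz := eq_or_ne z 0
  · exact ⟨0, by simp⟩
  · have hz' : (‖z‖ : 𝕜) ≠ 0 := by simpa using hz
    refine ⟨starRingEnd 𝕜 z / ‖z‖, by simp [hz], ?_⟩
    rw [← mul_div_assoc, RCLike.mul_conj]
    field_simp

theorem norm_sub_sum_smul_e (x : EllOne 𝕜 I) (s : Finset I) :
    ‖x - ∑ i ∈ s, x i • (e i : EllOne 𝕜 I)‖ = ‖x‖ - ∑ i ∈ s, ‖x i‖ := by
  classical
  have h (i : I) : x i • (e i : EllOne 𝕜 I) = lp.single 1 i (x i) := by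
    rw [e, ← lp.single_smul, smul_eq_mul, mul_one]
  simp only [h]
  simpa using! lp.norm_compl_sum_single (by simp) x s

/-- Almost disjointly supported vectors in a retract `X` of `ℓ₁(J)` span a copy of `ℓ₁` which is
complemented in `X`. -/
theorem exists_retract_of_disjoint [CompleteSpace X] {S J : Type*}
    (i : X →L[𝕜] EllOne 𝕜 J) (p : EllOne 𝕜 J →L[𝕜] X) (hpi : ∀ x, p (i x) = x)
    (F : S → Finset J) (hF : Pairwise fun s t => Disjoint (F s) (F t))
    (x : S → X) (hx : ∀ s, ‖i (x s)‖ = 1) (hxF : ∀ s, 3 / 4 < ∑ j ∈ F s, ‖i (x s) j‖) :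
    ∃ (j : EllOne 𝕜 S →L[𝕜] X) (q : X →L[𝕜] EllOne 𝕜 S), ∀ y, q (j y) = y := by
  -- `v γ` cancels the phase of the coordinate `γ`; disjointness of the sets `F s` leaves at most
  -- one `s` to serve.
  have hv (γ : J) : ∃ v : EllOne 𝕜 S, ‖v‖ ≤ 1 ∧
      ∀ s, γ ∈ F s → i (x s) γ • v = (‖i (x s) γ‖ : 𝕜) • e s := by
    by_cases h : ∃ s, γ ∈ F s
    · obtain ⟨s, hs⟩ := h
      obtain ⟨θ, hθ, h⟩ := exists_mul_eq_norm (i (x s) γ)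
      refine ⟨θ • e s, by simpa [norm_smul] using hθ, fun t ht => ?_⟩
      obtain rfl : s = t := by
        by_contra hst
        exact Finset.disjoint_left.1 (hF hst) hs ht
      rw [smul_smul, h]
    · exact ⟨0, by simp, fun s hs => (h ⟨s, hs⟩).elim⟩
  choose v hv1 hv using hv
  obtain ⟨U, hU, hU1⟩ := exists_clm (𝕜 := 𝕜) v 1 hv1
  obtain ⟨T, hT, -⟩ := exists_clm (𝕜 := 𝕜) x ‖p‖ fun s => by
    rw [← hpi (x s)]
    simpa [hx] using p.le_opNorm (i (x s))
  -- `U ∘ i ∘ T` is nearly the identity: if `F s` carries mass `m > 3/4`, the defect at `e s` is at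
  -- most `1 - m` from the diagonal plus `1 - m` from the tail, hence below `1/2`. A Neumann series
  -- inverts it.
  let W : EllOne 𝕜 S →L[𝕜] EllOne 𝕜 S := .id 𝕜 _ - U.comp (i.comp T)
  have hW (y) : ‖W y‖ ≤ 1 / 2 * ‖y‖ := by
    refine norm_apply_le (fun s => ?_) y
    set m := ∑ j ∈ F s, ‖i (x s) j‖ with hm
    have h1 : U (∑ γ ∈ F s, i (x s) γ • (e γ : EllOne 𝕜 J)) = (m : 𝕜) • e s := by
      simp only [map_sum, map_smul, hU]
      rw [Finset.sum_congr rfl fun γ hγ => hv γ s hγ, ← Finset.sum_smul, hm]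
      simp
    have h2 := norm_sub_sum_smul_e (i (x s)) (F s)
    rw [hx, ← hm] at h2
    have h3 : W (e s) = ((1 - m : ℝ) : 𝕜) • e s -
        U (i (x s) - ∑ γ ∈ F s, i (x s) γ • (e γ : EllOne 𝕜 J)) := by
      rw [map_sub, h1]
      simp only [W, sub_apply, ContinuousLinearMap.id_apply, ContinuousLinearMap.comp_apply, hT]
      push_cast
      module
    have h4 : ‖((1 - m : ℝ) : 𝕜) • (e s : EllOne 𝕜 S)‖ = 1 - m := by
      rw [norm_smul, norm_e, mul_one, RCLike.norm_ofReal, abs_of_nonneg]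
      rw [← h2]
      exact norm_nonneg _
    rw [h3]
    refine (norm_sub_le _ _).trans ?_
    have h5 := hU1 (i (x s) - ∑ γ ∈ F s, i (x s) γ • (e γ : EllOne 𝕜 J))
    rw [h2] at h5
    rw [h4]
    have := hxF s
    linarith
  have hW1 : ‖W‖ < 1 :=
    (W.opNorm_le_bound (by norm_num) hW).trans_lt (by norm_num)
  let N := Units.oneSub W hW1
  have hN : (N : EllOne 𝕜 S →L[𝕜] EllOne 𝕜 S) = U.comp (i.comp T) := by
    simp only [N, Units.val_oneSub, W]
    exact sub_sub_cancel _ _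
  refine ⟨T, (↑N⁻¹ : EllOne 𝕜 S →L[𝕜] EllOne 𝕜 S).comp (U.comp i), fun y => ?_⟩
  have := DFunLike.congr_fun N.inv_mul y
  rw [hN] at this
  exact this

theorem exists_maximal_disjoint {α : Type*} (P : Finset α → Prop) :
    ∃ S : Set (Finset α), (∀ F ∈ S, P F) ∧ S.PairwiseDisjoint id ∧
      ∀ F, P F → (∀ H ∈ S, Disjoint F H) → F ∈ S := by
  obtain ⟨S, hS⟩ := zorn_subset {S : Set (Finset α) | (∀ F ∈ S, P F) ∧ S.PairwiseDisjoint id}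
    fun c hc hchain => ⟨⋃₀ c, ⟨fun F ⟨s, hs, hF⟩ => (hc hs).1 F hF,
      (Set.pairwiseDisjoint_sUnion hchain.directedOn).2 fun s hs => (hc hs).2⟩,
      fun s hs => Set.subset_sUnion_of_mem hs⟩
  refine ⟨S, hS.prop.1, hS.prop.2, fun F hF hd => ?_⟩
  refine hS.le_of_ge (y := insert F S) ⟨?_, ?_⟩ (Set.subset_insert F S) (Set.mem_insert F S)
  · rintro H (rfl | hH)
    exacts [hF, hS.prop.1 H hH]
  · exact hS.prop.2.insert fun H hH _ => hd H hH

/-- Köthe's theorem: complemented subspaces of `ℓ₁(J)` are isomorphic to some `ℓ₁(I)`. -/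
theorem exists_equiv_of_retract {X J : Type u} [NormedAddCommGroup X] [NormedSpace 𝕜 X]
    [CompleteSpace X] (i : X →L[𝕜] EllOne 𝕜 J) (p : EllOne 𝕜 J →L[𝕜] X)
    (hpi : ∀ x, p (i x) = x) :
    ∃ I : Type u, Nonempty (X ≃L[𝕜] EllOne 𝕜 I) := by
  classical
  by_cases hfin : FiniteDimensional 𝕜 X
  · exact exists_equiv_of_finiteDimensional 𝕜 X
  -- `S` plays two roles: its witnesses span a complemented `ℓ₁(S)` in `X`, and maximality bounds
  -- the size of `X`, making `X` a retract of `ℓ₁(S)`.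
  obtain ⟨S, hS, hdisj, hmax⟩ := exists_maximal_disjoint fun F : Finset J =>
    ∃ x : X, ‖i x‖ = 1 ∧ 3 / 4 < ∑ j ∈ F, ‖i x j‖
  let G : Set J := ⋃ F : S, (F : Set J)
  obtain ⟨R, -, -, hR⟩ := exists_pull (𝕜 := 𝕜) (Subtype.val_injective (p := (· ∈ G)))
  -- Otherwise a finite set with mass above `7/8` keeps more than `7/8 - 1/8 = 3/4` outside `G`. By
  -- maximality that part belongs to `S`, so it lies inside `G` and is empty.
  have hbound1 (x : X) (hx : ‖i x‖ = 1) : 1 / 8 ≤ ‖R (i x)‖ := by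
    by_contra! hlt
    obtain ⟨F, hF⟩ := ((hasSum_norm (i x)).eventually_const_lt
      (show 7 / 8 < ‖i x‖ by rw [hx]; norm_num)).exists
    have hFG : ∑ j ∈ F with j ∈ G, ‖i x j‖ ≤ ‖R (i x)‖ := by
      rw [← Finset.sum_subtype_eq_sum_filter]
      refine (Finset.sum_congr rfl fun j _ => by rw [hR]).trans_le
        (sum_le_hasSum (F.subtype (· ∈ G)) (fun _ _ => norm_nonneg _) (hasSum_norm (R (i x))))
    have hsplit := Finset.sum_filter_add_sum_filter_not F (· ∈ G) fun j => ‖i x j‖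
    have hlarge : 3 / 4 < ∑ j ∈ F with j ∉ G, ‖i x j‖ := by linarith
    have hmem : F.filter (· ∉ G) ∈ S := hmax _ ⟨x, hx, hlarge⟩ fun H hH =>
      Finset.disjoint_left.2 fun j hj hjH =>
        (Finset.mem_filter.1 hj).2 (Set.mem_iUnion.2 ⟨⟨H, hH⟩, hjH⟩)
    have hempty : F.filter (· ∉ G) = ∅ := Finset.eq_empty_of_forall_notMem fun j hj =>
      (Finset.mem_filter.1 hj).2 (Set.mem_iUnion.2 ⟨⟨_, hmem⟩, hj⟩)
    rw [hempty, Finset.sum_empty] at hlarge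
    norm_num at hlarge
  have hbound (x : X) : ‖x‖ ≤ (‖p‖ * 8) * ‖R.comp i x‖ := by
    have h1 : ‖x‖ ≤ ‖p‖ * ‖i x‖ := by simpa [hpi] using p.le_opNorm (i x)
    obtain h0 | h0 := eq_or_ne (‖i x‖) 0
    · rw [h0, mul_zero] at h1
      exact h1.trans (by positivity)
    · have h2 := hbound1 ((‖i x‖ : 𝕜)⁻¹ • x) (by simp [norm_smul, h0])
      rw [map_smul, map_smul, norm_smul, norm_inv, RCLike.norm_ofReal, abs_norm,
        le_inv_mul_iff₀ (by positivity)] at h2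
      refine h1.trans ?_
      rw [mul_assoc]
      gcongr
      simp only [ContinuousLinearMap.comp_apply]
      linarith
  have hSinf : Infinite S := by
    by_contra hS'
    have : Finite S := not_infinite_iff_finite.1 hS'
    have : Finite G := Set.finite_iUnion fun F : S => (F : Finset J).finite_toSet
    refine hfin (Module.Finite.of_injective
      (LinearMap.pi fun g : G => (lp.evalCLM 𝕜 (fun _ : G => 𝕜) 1 g).toLinearMap ∘ₗ
        (R.comp i).toLinearMap) ?_)
    refine (injective_iff_map_eq_zero _).2 fun x hx => ?_
    have : R.comp i x = 0 := lp.ext (funext fun g => congrFun hx g)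
    simpa [this] using hbound x
  have hne (F : S) : ((F : Finset J) : Set J).Nonempty := by
    obtain ⟨x, -, hx⟩ := hS F F.2
    rw [Finset.coe_nonempty]
    by_contra! h
    rw [h, Finset.sum_empty] at hx
    norm_num at hx
  choose g hg using hne
  have hGinf : Infinite G := Infinite.of_injective
    (fun F : S => (⟨g F, Set.mem_iUnion.2 ⟨F, hg F⟩⟩ : G)) fun F H h => by
      by_contra hFH
      have hgFH : g F = g H := congrArg Subtype.val h
      exact Finset.disjoint_left.1 (hdisj F.2 H.2 (Subtype.coe_ne_coe.2 hFH)) (hg F)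
        (hgFH ▸ hg H)
  have hGS : Cardinal.mk G ≤ Cardinal.mk S := by
    refine (Cardinal.mk_iUnion_le _).trans ?_
    calc _ ≤ Cardinal.mk S * Cardinal.aleph0 := by
          gcongr
          exact ciSup_le' fun F => (Cardinal.mk_lt_aleph0_iff.2 (F : Finset J).finite_toSet).le
      _ = Cardinal.mk S := by simp
  obtain ⟨K, d, hd, hK⟩ := exists_dense_of_antilipschitz (R.comp i) _ hbound
  obtain ⟨i', p', hpi'⟩ := exists_retract_of_dense i p hpi d hd (hK.trans hGS)
  choose x hx hxF using hS
  obtain ⟨j, q, hqj⟩ := exists_retract_of_disjoint i p hpi (fun F : S => (F : Finset J))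
    (fun F H h => hdisj F.2 H.2 (Subtype.coe_ne_coe.2 h)) (fun F => x F F.2) (fun F => hx F F.2)
    (fun F => hxF F F.2)
  exact ⟨S, nonempty_equiv_of_retracts i' p' hpi' j q hqj⟩

end EllOne

/-! ### Morphisms out of colocal objects in a localization. -/

namespace CategoryTheory.MorphismProperty

universe w v

/-- The localization functor is bijective on morphisms out of a colocal object. -/
theorem bijective_Q_map_of_isColocal {C : Type w} [Category.{v} C] {W : MorphismProperty C} {X : C}
    (hX : W.isColocal X) (Y : C) : Function.Bijective (W.Q.map : (X ⟶ Y) → _) := by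
  constructor
  · intro f g hfg
    -- Colocality says that `Hom(X, -)` inverts `W`, so it extends to the localization; evaluating
    -- the extension at the identity of `X` recovers `k` from `W.Q.map k`.
    let F : C ⥤ Type v := coyoneda.obj (Opposite.op X)
    have hF : W.IsInvertedBy F := fun A B s hs => by
      rw [isIso_iff_bijective]
      exact hX s hs
    have h := congrArg (Localization.lift F hF W.Q).map hfg
    let α := Localization.fac F hF W.Q
    have hf (k : X ⟶ Y) : k = α.hom.app Y
        ((Localization.lift F hF W.Q).map (W.Q.map k) (α.inv.app X (𝟙 X))) := by
      have h1 : α.hom.app Y ((Localization.lift F hF W.Q).map (W.Q.map k) (α.inv.app X (𝟙 X))) =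
          F.map k (α.hom.app X (α.inv.app X (𝟙 X))) :=
        ConcreteCategory.congr_hom (α.hom.naturality k) _
      have h2 : α.hom.app X (α.inv.app X (𝟙 X)) = 𝟙 X :=
        ConcreteCategory.congr_hom (α.inv_hom_id_app X) (𝟙 X)
      rw [h1, h2]
      exact (Category.id_comp k).symm
    rw [hf f, hf g, h]
  · intro φ
    -- `P` holds when composition with `ψ` preserves arrows from `X` that come from `C`. It suffices
    -- to check the generators; for formal inverses, colocality supplies the lift.
    let P : MorphismProperty W.Localization := fun A B ψ =>
      ∀ f : W.Q.obj X ⟶ A, f ∈ Set.range (fun k : X ⟶ A.as.obj => W.Q.map k) →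
        f ≫ ψ ∈ Set.range (fun k : X ⟶ B.as.obj => W.Q.map k)
    have : P.IsStableUnderComposition := ⟨fun a b ha hb f hf => by
      rw [← Category.assoc]
      exact hb _ (ha f hf)⟩
    have hP : P = ⊤ := by
      refine Localization.Construction.morphismProperty_eq_top P ?_ ?_
      · rintro A B g _ ⟨k, rfl⟩
        exact ⟨k ≫ g, W.Q.map_comp k g⟩
      · rintro A B s hs _ ⟨k, rfl⟩
        obtain ⟨k', rfl⟩ := (hX s hs).2 k
        refine ⟨k', ?_⟩
        have h : W.Q.map s ≫ Localization.Construction.wInv s hs = 𝟙 _ :=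
          (Localization.Construction.wIso s hs).hom_inv_id
        change W.Q.map k' = W.Q.map (k' ≫ s) ≫ _
        rw [W.Q.map_comp, Category.assoc, h, Category.comp_id]
    have h : P φ := hP ▸ MorphismProperty.top_apply φ
    simpa using! h (𝟙 _) ⟨𝟙 X, W.Q.map_id X⟩

end CategoryTheory.MorphismProperty

/-! ### Pushouts and pullbacks of Banach spaces. -/

namespace Ban

variable {𝕜 : Type} [RCLike 𝕜]

/-- Every operator factors as a surjective operator followed by an injective one. -/
theorem exists_image {A : Type u} [NormedAddCommGroup A] [NormedSpace 𝕜 A] [CompleteSpace A]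
    {B : Type*} [NormedAddCommGroup B] [NormedSpace 𝕜 B] (T : A →L[𝕜] B) :
    ∃ (K : Ban.{u} 𝕜) (q : A →L[𝕜] K) (k : K →L[𝕜] B), Function.Surjective q ∧
      Function.Injective k ∧ ∀ x, k (q x) = T x := by
  have : IsClosed (T.ker : Set A) := T.isClosed_ker
  -- The quotient is complete even if the range of `T` is not closed.
  let k : (A ⧸ T.ker) →L[𝕜] B := ⟨T.ker.liftQ T.toLinearMap le_rfl, by
    exact T.continuous.quotient_lift _⟩
  refine ⟨⟨A ⧸ T.ker⟩, T.ker.mkQL, k, T.ker.mkQ_surjective, ?_, fun x => rfl⟩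
  exact LinearMap.ker_eq_bot.1 (Submodule.ker_liftQ_eq_bot _ _ _ le_rfl)

/-- Operators which vanish on the kernel of a surjective operator factor through it. -/
theorem exists_desc {A B D : Type*} [NormedAddCommGroup A] [NormedSpace 𝕜 A] [CompleteSpace A]
    [NormedAddCommGroup B] [NormedSpace 𝕜 B] [CompleteSpace B] [NormedAddCommGroup D]
    [NormedSpace 𝕜 D] (q : A →L[𝕜] B) (hq : Function.Surjective q) (t : A →L[𝕜] D)
    (ht : ∀ x, q x = 0 → t x = 0) : ∃ d : B →L[𝕜] D, ∀ x, d (q x) = t x := by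
  obtain ⟨C, hC, h⟩ := q.exists_preimage_norm_le hq
  choose g hg hgn using h
  -- The bounded section `g` need not be linear, but `t ∘ g` is, since `t` kills the kernel of `q`.
  have key (x) : t (g (q x)) = t x := by
    rw [← sub_eq_zero, ← map_sub]
    exact ht _ (by rw [map_sub, hg, sub_self])
  refine ⟨LinearMap.mkContinuous
    { toFun := fun y => t (g y)
      map_add' := fun y z => ?_
      map_smul' := fun c y => ?_ } (‖t‖ * C) fun y => ?_, key⟩
  · rw [← map_add, ← key (g y + g z), map_add, hg, hg]
  · rw [RingHom.id_apply, ← map_smul, ← key (c • g y), map_smul, hg]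
  · rw [mul_assoc]
    exact t.le_opNorm_of_le (hgn y)

/-- The image `K` of `c + d` is itself a cocone, so the identity of `Z` factors through `K → Z`,
which is therefore onto. -/
theorem exists_add_of_isPushout {W X Y Z : Ban.{u} 𝕜} {a : W ⟶ X} {b : W ⟶ Y} {c : X ⟶ Z}
    {d : Y ⟶ Z} (h : IsPushout a b c d) (z : Z) : ∃ x y, c.toCLM x + d.toCLM y = z := by
  obtain ⟨K, q, k, hq, hk, hqk⟩ := exists_image (c.toCLM.coprod d.toCLM)
  let q1 : X ⟶ K := ⟨q.comp (.inl 𝕜 X Y)⟩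
  let q2 : Y ⟶ K := ⟨q.comp (.inr 𝕜 X Y)⟩
  let k' : K ⟶ Z := ⟨k⟩
  have h1 : q1 ≫ k' = c := by ext x; simp [q1, k', hqk]
  have h2 : q2 ≫ k' = d := by ext x; simp [q2, k', hqk]
  have hw : a ≫ q1 = b ≫ q2 := by
    ext x
    apply hk
    have := DFunLike.congr_fun (congrArg Hom.toCLM h.w) x
    simpa [q1, q2, hqk] using this
  have hs : h.desc q1 q2 hw ≫ k' = 𝟙 Z := by
    apply h.hom_ext
    · rw [h.inl_desc_assoc, h1, Category.comp_id]
    · rw [h.inr_desc_assoc, h2, Category.comp_id]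
  obtain ⟨w, hw'⟩ := hq ((h.desc q1 q2 hw).toCLM z)
  refine ⟨w.1, w.2, ?_⟩
  have h3 : k ((h.desc q1 q2 hw).toCLM z) = z := DFunLike.congr_fun (congrArg Hom.toCLM hs) z
  rw [← hw', hqk] at h3
  simpa using h3

theorem exists_lift_of_isPullback {P W X Y Z : Ban.{u} 𝕜} {a : W ⟶ X} {b : W ⟶ Y} {c : X ⟶ Z}
    {d : Y ⟶ Z} (h : IsPullback a b c d) (α : P →L[𝕜] X) (β : P →L[𝕜] Y)
    (hαβ : ∀ x, c.toCLM (α x) = d.toCLM (β x)) :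
    ∃ γ : P →L[𝕜] W, (∀ x, a.toCLM (γ x) = α x) ∧ ∀ x, b.toCLM (γ x) = β x := by
  let α' : P ⟶ X := ⟨α⟩
  let β' : P ⟶ Y := ⟨β⟩
  have hw : α' ≫ c = β' ≫ d := by
    ext x
    exact hαβ x
  exact ⟨(h.lift α' β' hw).toCLM,
    DFunLike.congr_fun (congrArg Hom.toCLM (h.lift_fst α' β' hw)),
    DFunLike.congr_fun (congrArg Hom.toCLM (h.lift_snd α' β' hw))⟩

/-- The pullback of an injective operator along a surjective operator. -/
theorem exists_bicartesianSq {X Y Z : Ban.{u} 𝕜} (c : X ⟶ Z) (d : Y ⟶ Z)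
    (hc : Function.Injective c.toCLM) (hd : Function.Surjective d.toCLM) :
    ∃ (W : Ban.{u} 𝕜) (a : W ⟶ X) (b : W ⟶ Y), Function.Injective b.toCLM ∧
      BicartesianSq a b c d := by
  let T : X × Y →L[𝕜] Z := c.toCLM.coprod (-d.toCLM)
  have : CompleteSpace T.ker := T.isClosed_ker.completeSpace_coe
  have hT (w : X × Y) : w ∈ T.ker ↔ c.toCLM w.1 = d.toCLM w.2 := by
    simp [T, LinearMap.mem_ker, add_neg_eq_zero]
  let W : Ban.{u} 𝕜 := ⟨T.ker⟩
  let a : W ⟶ X := ⟨(ContinuousLinearMap.fst 𝕜 X Y).comp T.ker.subtypeL⟩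
  let b : W ⟶ Y := ⟨(ContinuousLinearMap.snd 𝕜 X Y).comp T.ker.subtypeL⟩
  have hw : a ≫ c = b ≫ d := by
    ext w
    exact (hT w.1).1 w.2
  refine ⟨W, a, b, fun v w hvw => ?_, ⟨⟨hw⟩, ⟨Limits.PullbackCone.IsLimit.mk hw
    (fun s => ⟨(s.fst.toCLM.prod s.snd.toCLM).codRestrict T.ker fun x => (hT _).2
      (DFunLike.congr_fun (congrArg Hom.toCLM s.condition) x)⟩) (fun s => rfl) (fun s => rfl)
    fun s m h1 h2 => ?_⟩⟩, ?_⟩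
  · refine Subtype.ext (Prod.ext (hc ?_) hvw)
    rw [(hT v.1).1 v.2, (hT w.1).1 w.2]
    exact congrArg d.toCLM hvw
  · ext x
    · exact DFunLike.congr_fun (congrArg Hom.toCLM h1) x
    · exact DFunLike.congr_fun (congrArg Hom.toCLM h2) x
  · have key (s : Limits.PushoutCocone a b) : ∃ m : Z ⟶ s.pt, c ≫ m = s.inl ∧ d ≫ m = s.inr := by
      have hs (w : X × Y) (hw : c.toCLM w.1 = d.toCLM w.2) :
          s.inl.toCLM w.1 = s.inr.toCLM w.2 :=
        DFunLike.congr_fun (congrArg Hom.toCLM s.condition) (⟨w, (hT w).2 hw⟩ : T.ker)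
      obtain ⟨m, hm⟩ := exists_desc d.toCLM hd s.inr.toCLM fun y hy => by
        simpa using (hs (0, y) (by simp [hy])).symm
      refine ⟨⟨m⟩, ?_, ?_⟩
      · ext x
        obtain ⟨y, hy⟩ := hd (c.toCLM x)
        change m (c.toCLM x) = _
        rw [← hy, hm]
        exact (hs (x, y) hy.symm).symm
      · ext y
        exact hm y
    choose m hm1 hm2 using key
    exact ⟨Limits.PushoutCocone.IsColimit.mk hw m hm1 hm2 fun s m' h1 h2 => by
      ext z
      obtain ⟨y, rfl⟩ := hd z
      exact (DFunLike.congr_fun (congrArg Hom.toCLM (h2.trans (hm2 s).symm)) y)⟩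

/-- A Banach space is of type `ℓ₁` if it is isomorphic to some `ℓ₁(I)`. -/
def IsEllOne (X : Ban.{u} 𝕜) : Prop := ∃ I : Type u, Nonempty (X ≃L[𝕜] EllOne 𝕜 I)

theorem IsEllOne.exists_lift {P : Ban.{u} 𝕜} (hP : P.IsEllOne) {A B : Type*}
    [NormedAddCommGroup A] [NormedSpace 𝕜 A] [CompleteSpace A]
    [NormedAddCommGroup B] [NormedSpace 𝕜 B] [CompleteSpace B] (T : A →L[𝕜] B)
    (hT : Function.Surjective T) (S : P →L[𝕜] B) : ∃ S' : P →L[𝕜] A, ∀ x, T (S' x) = S x := by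
  obtain ⟨I, ⟨φ⟩⟩ := hP
  obtain ⟨S', hS'⟩ := EllOne.exists_lift T hT (S.comp φ.symm.toContinuousLinearMap)
  refine ⟨S'.comp φ.toContinuousLinearMap, fun x => ?_⟩
  simpa using DFunLike.congr_fun hS' (φ x)

theorem IsEllOne.of_retract {P X : Ban.{u} 𝕜} (hP : P.IsEllOne) (i : X →L[𝕜] P) (p : P →L[𝕜] X)
    (hpi : ∀ x, p (i x) = x) : X.IsEllOne := by
  obtain ⟨I, ⟨φ⟩⟩ := hP
  exact EllOne.exists_equiv_of_retract (φ.toContinuousLinearMap.comp i)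
    (p.comp φ.symm.toContinuousLinearMap) fun x => by simp [hpi]

end Ban

/-! ### Resolutions, epimorphisms and projectives in `W`. -/

namespace BanMono

variable {𝕜 : Type} [RCLike 𝕜]

/-- The injective operator underlying an object of `M`. -/
abbrev op (f : BanMono.{u} 𝕜) : f.obj.left →L[𝕜] f.obj.right := f.obj.hom.toCLM

/-- The first component of a morphism of `M`. -/
abbrev fst {f g : BanMono.{u} 𝕜} (v : f ⟶ g) : f.obj.left →L[𝕜] g.obj.left := v.hom.left.toCLM

/-- The second component of a morphism of `M`. -/
abbrev snd {f g : BanMono.{u} 𝕜} (v : f ⟶ g) : f.obj.right →L[𝕜] g.obj.right := v.hom.right.toCLM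

theorem snd_op {f g : BanMono.{u} 𝕜} (v : f ⟶ g) (x : f.obj.left) :
    snd v (f.op x) = g.op (fst v x) :=
  (DFunLike.congr_fun (congrArg Ban.Hom.toCLM v.hom.w) x).symm

/-- A morphism of `M` is a commutative square. -/
def mkHom {f g : BanMono.{u} 𝕜} (a : f.obj.left →L[𝕜] g.obj.left)
    (b : f.obj.right →L[𝕜] g.obj.right) (h : ∀ x, b (f.op x) = g.op (a x)) : f ⟶ g :=
  ObjectProperty.homMk (Arrow.homMk ⟨a⟩ ⟨b⟩ (by ext x; exact (h x).symm))

/-- Injectivity of `g` makes the condition on first components automatic. -/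
theorem homotopic_of_snd {f g : BanMono.{u} 𝕜} {v w : f ⟶ g} (r : f.obj.right →L[𝕜] g.obj.left)
    (h : ∀ x, snd v x - snd w x = g.op (r x)) : homotopic v w := by
  refine ⟨r, ContinuousLinearMap.ext h, ContinuousLinearMap.ext fun x => g.property ?_⟩
  have h' := h (f.op x)
  rw [snd_op, snd_op, ← map_sub] at h'
  exact h'

variable (𝕜) in
/-- The functor from `M` to `W`. -/
noncomputable abbrev toWaelbroeck : BanMono.{u} 𝕜 ⥤ Waelbroeck.{u} 𝕜 :=
  Quotient.functor homotopic ⋙ (pulations 𝕜).Q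

theorem toWaelbroeck_map_eq {f g : BanMono.{u} 𝕜} {v w : f ⟶ g} (h : homotopic v w) :
    (toWaelbroeck 𝕜).map v = (toWaelbroeck 𝕜).map w :=
  congrArg (pulations 𝕜).Q.map (CategoryTheory.Quotient.sound _ h)

theorem toWaelbroeck_obj_surjective : Function.Surjective (toWaelbroeck.{u} 𝕜).obj := fun F => by
  obtain ⟨g, rfl⟩ := (Localization.Construction.objEquiv (pulations.{u} 𝕜)).surjective F
  exact ⟨g.as, rfl⟩

/-- For a pulation `v : g ⟶ h`, injectivity glues a homotopy into `h` and a difference of second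
components to a homotopy into the pullback. For surjectivity, the pushout makes `h` and `snd v`
jointly onto, so `snd w = h b + snd v a` by lifting; `b` is the homotopy and the pullback provides
the first component of the lift. -/
theorem isColocal {f : BanMono.{u} 𝕜} (hf : f.obj.right.IsEllOne) :
    (pulations 𝕜).isColocal ((Quotient.functor homotopic).obj f) := by
  rintro g h _ ⟨v, rfl, hv⟩
  constructor
  · intro φ ψ hφψ
    obtain ⟨w, rfl⟩ := (Quotient.functor homotopic).map_surjective φ
    obtain ⟨w', rfl⟩ := (Quotient.functor homotopic).map_surjective ψ
    obtain ⟨r, hr, -⟩ : homotopic (w ≫ v) (w' ≫ v) := by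
      rw [← Quotient.functor_map_eq_iff homotopic]
      simpa only [Functor.map_comp] using! hφψ
    obtain ⟨ρ, -, hρ⟩ := Ban.exists_lift_of_isPullback hv.toIsPullback r (snd w - snd w') fun x => by
      have := DFunLike.congr_fun hr x
      rw [sub_apply, map_sub]
      exact this.symm
    exact CategoryTheory.Quotient.sound _ (homotopic_of_snd ρ fun x => (hρ x).symm)
  · intro φ
    obtain ⟨w, rfl⟩ := (Quotient.functor homotopic).map_surjective φ
    obtain ⟨S, hS⟩ := hf.exists_lift (h.as.op.coprod (snd v)) (fun z => by
      obtain ⟨x, y, h⟩ := Ban.exists_add_of_isPushout hv.toIsPushout z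
      exact ⟨(x, y), h⟩) (snd w)
    let b := (ContinuousLinearMap.fst 𝕜 _ _).comp S
    let a := (ContinuousLinearMap.snd 𝕜 _ _).comp S
    have hab (x) : h.as.op (b x) + snd v (a x) = snd w x := hS x
    obtain ⟨γ, hγ, hγ'⟩ := Ban.exists_lift_of_isPullback hv.toIsPullback
      (fst w - b.comp f.op) (a.comp f.op) fun x => by
        have h1 := hab (f.op x)
        rw [snd_op] at h1
        rw [sub_apply, map_sub, sub_eq_iff_eq_add, add_comm]
        exact h1.symm
    refine ⟨(Quotient.functor homotopic).map (mkHom γ a fun x => (hγ' x).symm), ?_⟩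
    refine Eq.trans ((Quotient.functor homotopic).map_comp _ _).symm
      (CategoryTheory.Quotient.sound _ (homotopic_of_snd (-b) fun x => ?_))
    change snd v (a x) - snd w x = h.as.op (- b x)
    rw [← hab, map_neg]
    abel

theorem toWaelbroeck_map_eq_iff {f g : BanMono.{u} 𝕜} (hf : f.obj.right.IsEllOne) {v w : f ⟶ g} :
    (toWaelbroeck 𝕜).map v = (toWaelbroeck 𝕜).map w ↔ homotopic v w :=
  ⟨fun h => (Quotient.functor_map_eq_iff homotopic _ _).1
    ((MorphismProperty.bijective_Q_map_of_isColocal (isColocal hf) _).1 h), toWaelbroeck_map_eq⟩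

theorem toWaelbroeck_map_surjective {f g : BanMono.{u} 𝕜} (hf : f.obj.right.IsEllOne)
    (φ : (toWaelbroeck 𝕜).obj f ⟶ (toWaelbroeck 𝕜).obj g) :
    ∃ v : f ⟶ g, (toWaelbroeck 𝕜).map v = φ := by
  obtain ⟨ψ, hψ⟩ := (MorphismProperty.bijective_Q_map_of_isColocal (isColocal hf) _).2 φ
  obtain ⟨v, rfl⟩ := (Quotient.functor homotopic).map_surjective ψ
  exact ⟨v, hψ⟩

/-- Every object of `W` is isomorphic to some `X' → ℓ₁(I)`. -/
theorem exists_resolution (F : Waelbroeck.{u} 𝕜) :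
    ∃ f : BanMono.{u} 𝕜, f.obj.right.IsEllOne ∧ Nonempty (F ≅ (toWaelbroeck 𝕜).obj f) := by
  obtain ⟨g, rfl⟩ := toWaelbroeck_obj_surjective F
  obtain ⟨I, q, hq⟩ := EllOne.exists_surjective 𝕜 g.obj.right
  let d : Ban.ell1 𝕜 I ⟶ g.obj.right := ⟨q⟩
  obtain ⟨W, a, b, hb, hsq⟩ := Ban.exists_bicartesianSq g.obj.hom d g.property hq
  let f : BanMono.{u} 𝕜 := ⟨Arrow.mk b, hb⟩
  let v : f ⟶ g := ObjectProperty.homMk (Arrow.homMk a d hsq.w)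
  have hv : pulations 𝕜 ((Quotient.functor homotopic).map v) :=
    ⟨v, rfl, hsq⟩
  exact ⟨f, ⟨I, ⟨.refl 𝕜 _⟩⟩, ⟨(Localization.Construction.wIso _ hv).symm⟩⟩

/-- Let `k` be the injective part of the joint operator. The morphism `c : h ⟶ k'` becomes null
after composition with `v`, hence is null; its null-homotopy is a right inverse of `k`. -/
theorem exists_add_of_epi {g h : BanMono.{u} 𝕜} (hh : h.obj.right.IsEllOne) (v : g ⟶ h)
    [Epi ((toWaelbroeck 𝕜).map v)] :
    Function.Surjective ((snd v).coprod h.op) := by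
  obtain ⟨K, q, k, hq, hk, hqk⟩ := Ban.exists_image ((snd v).coprod h.op)
  let k' : BanMono.{u} 𝕜 := ⟨Arrow.mk (⟨k⟩ : K ⟶ h.obj.right), hk⟩
  let c : h ⟶ k' := mkHom (q.comp (.inr 𝕜 _ _)) (.id 𝕜 _) fun x => by
    simpa using! (hqk (0, x)).symm
  let c₀ : h ⟶ k' := mkHom 0 0 fun x => by simp
  have hc : homotopic (v ≫ c) (v ≫ c₀) := homotopic_of_snd (q.comp (.inl 𝕜 _ _)) fun x => by
    change snd v x - 0 = k (q (x, 0))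
    simp [hqk]
  have hc' := toWaelbroeck_map_eq hc
  rw [Functor.map_comp, Functor.map_comp, cancel_epi, toWaelbroeck_map_eq_iff hh] at hc'
  obtain ⟨r, hr, -⟩ := hc'
  intro z
  obtain ⟨y, hy⟩ := hq (r z)
  refine ⟨y, ?_⟩
  have h : z - 0 = k (r z) := DFunLike.congr_fun hr z
  rw [← hqk, hy, ← h, sub_zero]

theorem projective_of_isEllOne {X : Ban.{u} 𝕜} (hX : X.IsEllOne) :
    Projective ((Waelbroeck.ofBan 𝕜).obj X) := by
  change Projective ((toWaelbroeck 𝕜).obj ((ofBan 𝕜).obj X))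
  refine ⟨fun {A Z} m e he => ?_⟩
  obtain ⟨g, hg, ⟨α⟩⟩ := exists_resolution A
  obtain ⟨h, hh, ⟨ζ⟩⟩ := exists_resolution Z
  obtain ⟨v, hv⟩ := toWaelbroeck_map_surjective hg (α.inv ≫ e ≫ ζ.hom)
  obtain ⟨w, hw⟩ := toWaelbroeck_map_surjective (f := (ofBan 𝕜).obj X) hX (m ≫ ζ.hom)
  have : Epi ((toWaelbroeck 𝕜).map v) := by
    rw [hv]
    infer_instance
  -- The first component of `S` is the lift, the second is the homotopy up to sign.
  obtain ⟨S, hS⟩ := hX.exists_lift _ (exists_add_of_epi hh v) (snd w)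
  let t : (ofBan 𝕜).obj X ⟶ g := mkHom 0 ((ContinuousLinearMap.fst 𝕜 _ _).comp S) fun x => by
    change (S 0).1 = g.op 0
    rw [map_zero, map_zero]
    rfl
  have ht : homotopic (t ≫ v) w :=
    homotopic_of_snd (-((ContinuousLinearMap.snd 𝕜 _ _).comp S)) fun x => by
      have h1 : snd v (S x).1 + h.op (S x).2 = snd w x := hS x
      change snd v (S x).1 - snd w x = h.op (- (S x).2)
      rw [← h1, map_neg]
      abel
  have ht' := toWaelbroeck_map_eq ht
  rw [Functor.map_comp, hv, hw] at ht'
  refine ⟨(toWaelbroeck 𝕜).map t ≫ α.inv, (cancel_mono ζ.hom).1 ?_⟩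
  rw [Category.assoc, Category.assoc]
  exact ht'

theorem exists_iso_of_projective {f : BanMono.{u} 𝕜} (hf : f.obj.right.IsEllOne)
    [Projective ((toWaelbroeck 𝕜).obj f)] : ∃ X : Ban.{u} 𝕜, X.IsEllOne ∧
      Nonempty ((toWaelbroeck 𝕜).obj f ≅ (toWaelbroeck 𝕜).obj ((ofBan 𝕜).obj X)) := by
  let P := f.obj.right
  let π : (ofBan 𝕜).obj P ⟶ f := mkHom 0 (.id 𝕜 _) fun x => (map_zero f.op).symm
  have hπ : Epi ((toWaelbroeck 𝕜).map π) := ⟨fun {Z} a b hab => by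
    obtain ⟨z, rfl⟩ := toWaelbroeck_obj_surjective Z
    obtain ⟨v, rfl⟩ := toWaelbroeck_map_surjective hf a
    obtain ⟨w, rfl⟩ := toWaelbroeck_map_surjective hf b
    rw [← Functor.map_comp, ← Functor.map_comp,
      toWaelbroeck_map_eq_iff (f := (ofBan 𝕜).obj P) hf] at hab
    obtain ⟨r, hr, -⟩ := hab
    exact toWaelbroeck_map_eq (homotopic_of_snd r (DFunLike.congr_fun hr))⟩
  obtain ⟨σ, hσ⟩ := toWaelbroeck_map_surjective hf
    (Projective.factorThru (𝟙 _) ((toWaelbroeck 𝕜).map π))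
  have hσπ : homotopic (σ ≫ π) (𝟙 f) := by
    rw [← toWaelbroeck_map_eq_iff hf, Functor.map_comp, hσ, Projective.factorThru_comp]
    exact ((toWaelbroeck 𝕜).map_id f).symm
  obtain ⟨r, hr, hr'⟩ := hσπ
  -- The first component of `σ ≫ π` passes through the zero space, which leaves `-x`.
  have h1 (x) : r (f.op x) = -x := by
    have h : (0 : f.obj.left) - x = r (f.op x) := DFunLike.congr_fun hr' x
    rw [← h, zero_sub]
  have : CompleteSpace r.ker := r.isClosed_ker.completeSpace_coe
  let X : Ban.{u} 𝕜 := ⟨r.ker⟩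
  let i : X →L[𝕜] P := r.ker.subtypeL
  -- The projection onto `r.ker` along the range of `f`; the plus sign comes from `r ∘ f = -1`.
  let p : P →L[𝕜] X := (.id 𝕜 _ + f.op.comp r).codRestrict r.ker fun x => by
    simp [LinearMap.mem_ker, h1]
  have hi (x : X) : r (i x) = 0 := x.2
  have hip (x : P) : i (p x) = x + f.op (r x) := rfl
  have hpi (x : X) : p (i x) = x := Subtype.ext <| by
    change i (p (i x)) = i x
    rw [hip, hi, map_zero, add_zero]
  have hpf (x) : p (f.op x) = 0 := Subtype.ext <| by
    change i (p (f.op x)) = 0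
    rw [hip, h1, map_neg, add_neg_cancel]
  let a : f ⟶ (ofBan 𝕜).obj X := mkHom 0 p hpf
  let b : (ofBan 𝕜).obj X ⟶ f := mkHom 0 i fun x => (map_zero f.op).symm
  have hab : homotopic (a ≫ b) (𝟙 f) := homotopic_of_snd r fun x => by
    change i (p x) - x = _
    rw [hip, add_sub_cancel_left]
  have hba : homotopic (b ≫ a) (𝟙 _) := homotopic_of_snd 0 fun (x : X) => by
    change p (i x) - x = 0
    rw [hpi, sub_self]
  refine ⟨X, hf.of_retract i p hpi, ⟨(toWaelbroeck 𝕜).map a, (toWaelbroeck 𝕜).map b, ?_, ?_⟩⟩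
  · rw [← Functor.map_comp, toWaelbroeck_map_eq hab]
    exact (toWaelbroeck 𝕜).map_id f
  · rw [← Functor.map_comp, toWaelbroeck_map_eq hba]
    exact (toWaelbroeck 𝕜).map_id _

end BanMono

theorem Ban.IsEllOne.exists_iso {𝕜 : Type} [RCLike 𝕜] {X : Ban.{u} 𝕜} (hX : X.IsEllOne) :
    ∃ I : Type u, Nonempty (X ≅ Ban.ell1 𝕜 I) := by
  obtain ⟨I, ⟨φ⟩⟩ := hX
  refine ⟨I, ⟨⟨φ.toContinuousLinearMap⟩, ⟨φ.symm.toContinuousLinearMap⟩, ?_, ?_⟩⟩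
  · ext x
    exact φ.symm_apply_apply x
  · apply Ban.hom_ext
    exact ContinuousLinearMap.ext φ.apply_symm_apply

theorem mainTheorem2 {𝕜 : Type} [RCLike 𝕜] (f : Waelbroeck.{u} 𝕜) :
    CategoryTheory.Projective f ↔ ∃ I : Type u, Nonempty (f ≅ (Waelbroeck.ofBan 𝕜).obj (Ban.ell1 𝕜 I)) := by
  constructor
  · intro hf
    obtain ⟨p, hp, ⟨α⟩⟩ := BanMono.exists_resolution f
    have := Projective.of_iso α hf
    obtain ⟨X, hX, ⟨β⟩⟩ := BanMono.exists_iso_of_projective hp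
    obtain ⟨I, ⟨γ⟩⟩ := hX.exists_iso
    exact ⟨I, ⟨α ≪≫ β ≪≫ (Waelbroeck.ofBan 𝕜).mapIso γ⟩⟩
  · rintro ⟨I, ⟨α⟩⟩
    exact Projective.of_iso α.symm (BanMono.projective_of_isEllOne ⟨I, ⟨.refl 𝕜 _⟩⟩)
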